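/- Let $M$ be a nontrivial densely linearly ordered abelian group and let $\mathcal M=(M,<,+,0,\ldots)$ be a first-order structure expanding it. "Definable" means definable in $\mathcal M$ with parameters from $M$, a function is definable if its graph is, $M$ carries the order topology and $M^n$ the product topology. A bounded open interval is a set $]a,b[$ with $a<b$ in $M$; an unbounded open interval is one of $]a,+\infty[$, $]-\infty,b[$ $(a,b\in M)$ or $M$; an open interval is either of these, and an open box in $M^n$ is a product of $n$ open intervals. Assume: 1. ($\mathcal M$ is definably complete.) Every definable subset of $M$ has a supremum and an infimum in $M\cup\{\pm\infty\}$. 2. ($\mathcal M$ is uniformly locally o-minimal of the second kind.) $\mathcal M$ is locally o-minimal, i.e. for every definable $X\subseteq M$ and $a\in M$ there is an open interval $I\ni a$ such that $X\cap I$ is a finite union of points and open intervals; moreover, for every positive integer $n$, every definable $X\subseteq M^{n+1}=M\times M^n$, every $a\in M$ and every $b\in M^n$, there are an open interval $I\ni a$ and an open box $B\ni b$ such that $\{x\in M\mid (x,y)\in X\}\cap I$ is a finite union of points and open intervals for every $y\in B$. (A structure as above satisfying 1 and 2 is called a DCULOAS structure.) 3. ($\mathcal M$ is archimedean.) For all positive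 $a,b\in M$ there is a positive integer $n$ with $na>b$. 4. ($\mathcal M$ has the definable Tietze extension property.) For every positive integer $n$, every definable closed set $A\subseteq M^n$ and every continuous definable function $f:A\to M$, there is a continuous definable function $F:M^n\to M$ extending $f$. Then there is a strictly monotone definable homeomorphism between a bounded open interval and an unbounded open interval of $M$, and $\mathcal M$ is o-minimal, i.e. every definable subset of $M$ is a finite union of points and open intervals. -/

import Mathlib

universe u v w

namespace LocOMin

open Set

section Order

variable {M : Type w} [LinearOrder M]

/-- A bounded open interval `]a,b[` with `a < b` in `M`. -/
def IsBoundedOpenInterval (I : Set M) : Prop :=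
  ∃ a b : M, a < b ∧ I = Ioo a b

/-- An unbounded open interval: `]a,+∞[`, `]-∞,b[` or `M`. -/
def IsUnboundedOpenInterval (I : Set M) : Prop :=
  (∃ a : M, I = Ioi a) ∨ (∃ b : M, I = Iio b) ∨ I = univ

/-- An open interval, with endpoints in `M ∪ {±∞}`. -/
def IsOpenInterval (I : Set M) : Prop :=
  IsBoundedOpenInterval I ∨ IsUnboundedOpenInterval I

/-- An open box in `Mⁿ`: a product of `n` open intervals. -/
def IsOpenBox {n : ℕ} (B : Set (Fin n → M)) : Prop :=
  ∃ I : Fin n → Set M, (∀ i, IsOpenInterval (I i)) ∧ B = Set.pi univ I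

/-- `X` is a finite union of points and open intervals. -/
def IsFiniteUnionOfPointsAndIntervals (X : Set M) : Prop :=
  ∃ S : Set (Set M), S.Finite ∧
    (∀ s ∈ S, (∃ x : M, s = {x}) ∨ IsOpenInterval s) ∧ X = ⋃₀ S

end Order

section Definability

/-- "Definable" means definable with arbitrary parameters from `M`; this is for subsets of `Mⁿ`. -/
def IsDefinable (L : FirstOrder.Language.{u, v}) {M : Type w} [L.Structure M] {n : ℕ}
    (X : Set (Fin n → M)) : Prop :=
  (univ : Set M).Definable L X

/-- Definability (with parameters) of a subset of `M`. -/
def IsDefinable₁ (L : FirstOrder.Language.{u, v}) {M : Type w} [L.Structure M] (X : Set M) : Prop :=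
  (univ : Set M).Definable₁ L X

/-- A function `f : A → M` on a subset `A` of `Mⁿ` is definable if its graph, a subset of
`Mⁿ⁺¹`, is definable. -/
def IsDefinableFun (L : FirstOrder.Language.{u, v}) {M : Type w} [L.Structure M] {n : ℕ}
    {A : Set (Fin n → M)} (f : A → M) : Prop :=
  IsDefinable L {p : Fin (n + 1) → M | ∃ a : A, p = Fin.snoc (a : Fin n → M) (f a)}

/-- A map `f : I → J` between subsets of `M` is definable if its graph, a subset of `M × M`,
is definable. -/
def IsDefinableMap₁ (L : FirstOrder.Language.{u, v}) {M : Type w} [L.Structure M] {I J : Set M}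
    (f : I → J) : Prop :=
  (univ : Set M).Definable₂ L {p : M × M | ∃ t : I, p = ((t : M), (f t : M))}

end Definability

section Structures

variable (L : FirstOrder.Language.{u, v}) (M : Type w) [L.Structure M]

/-- The `L`-structure on `M` expands the ordered group `(M, <, +, 0)`: the language has symbols
that are interpreted as `<`, `+` and `0`. -/
structure IsExpansionOfOrderedGroup [LinearOrder M] [AddCommGroup M] : Prop where
  exists_lt : ∃ r : L.Relations 2, ∀ x : Fin 2 → M, FirstOrder.Language.Structure.RelMap r x ↔ x 0 < x 1
  exists_add : ∃ f : L.Functions 2, ∀ x : Fin 2 → M, FirstOrder.Language.Structure.funMap f x = x 0 + x 1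
  exists_zero : ∃ c : L.Functions 0, ∀ x : Fin 0 → M, FirstOrder.Language.Structure.funMap c x = 0

/-- Every definable subset of `M` has a supremum and an infimum in `M ∪ {±∞}`. -/
def DefinablyComplete [LinearOrder M] : Prop :=
  ∀ X : Set M, IsDefinable₁ L X → X.Nonempty →
    (BddAbove X → ∃ s : M, IsLUB X s) ∧ (BddBelow X → ∃ s : M, IsGLB X s)

/-- Every definable subset of `M` is a finite union of points and open intervals. -/
def OMinimal [LinearOrder M] : Prop :=
  ∀ X : Set M, IsDefinable₁ L X → IsFiniteUnionOfPointsAndIntervals X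

/-- For every definable `X ⊆ M` and every `a ∈ M` there is an open interval `I ∋ a` such that
`X ∩ I` is a finite union of points and open intervals. -/
def LocallyOMinimal [LinearOrder M] : Prop :=
  ∀ X : Set M, IsDefinable₁ L X → ∀ a : M,
    ∃ I : Set M, IsOpenInterval I ∧ a ∈ I ∧ IsFiniteUnionOfPointsAndIntervals (X ∩ I)

/-- Uniform local o-minimality of the second kind: the structure is locally o-minimal and, for
every `n ≥ 1`, definable `X ⊆ Mⁿ⁺¹ = M × Mⁿ`, `a ∈ M` and `b ∈ Mⁿ`, there are an open interval
`I ∋ a` and an open box `B ∋ b` such that for every `y ∈ B` the set `X_y ∩ I` is a finite union of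
points and open intervals, where `X_y = {x | (x, y) ∈ X}`. -/
def UniformlyLocallyOMinimalSecondKind [LinearOrder M] : Prop :=
  LocallyOMinimal L M ∧
  ∀ n : ℕ, 1 ≤ n → ∀ X : Set (Fin (n + 1) → M), IsDefinable L X →
    ∀ (a : M) (b : Fin n → M),
      ∃ (I : Set M) (B : Set (Fin n → M)), IsOpenInterval I ∧ a ∈ I ∧ IsOpenBox B ∧ b ∈ B ∧
        ∀ y ∈ B, IsFiniteUnionOfPointsAndIntervals
          ({x : M | (Fin.cons x y : Fin (n + 1) → M) ∈ X} ∩ I)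

/-- A definably complete uniformly locally o-minimal expansion of the second kind of a densely
linearly ordered abelian group. (That `M` is a nontrivial densely linearly ordered abelian group is
expressed by the type classes.) -/
structure IsDCULOAS [LinearOrder M] [AddCommGroup M] [IsOrderedAddMonoid M] [DenselyOrdered M]
    [Nontrivial M] : Prop where
  expansion : IsExpansionOfOrderedGroup L M
  definablyComplete : DefinablyComplete L M
  uniformlyLocallyOMinimal : UniformlyLocallyOMinimalSecondKind L M

/-- The definable Tietze extension property. -/
def DefinableTietze [TopologicalSpace M] : Prop :=
  ∀ n : ℕ, 1 ≤ n → ∀ A : Set (Fin n → M), IsDefinable L A → IsClosed A →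
    ∀ f : A → M, Continuous f → IsDefinableFun L f →
      ∃ F : (Fin n → M) → M, Continuous F ∧
        IsDefinableFun L (fun x : (univ : Set (Fin n → M)) => F x) ∧ ∀ a : A, F a = f a

/-- There is a strictly monotone definable homeomorphism from a bounded open interval onto an
unbounded open interval. -/
def HasBoundedUnboundedHomeo [LinearOrder M] [TopologicalSpace M] : Prop :=
  ∃ I J : Set M, IsBoundedOpenInterval I ∧ IsUnboundedOpenInterval J ∧
    ∃ φ : I ≃ₜ J, (StrictMono φ ∨ StrictAnti φ) ∧ IsDefinableMap₁ L φ

end Structures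

end LocOMin

/-! Fix `u > 0`. The Tietze property, applied to the union of the two lines `y = 0` and `y = u`,
gives a continuous definable `G` with `G x 0 = 0` and `G x u = x`
(`DefinableTietze.exists_interpolation`). If `G x ·` oscillated by less than `u` near every height,
uniformly in all `x`, definable compactness of `[0, u]` and finitely many steps (archimedeanity)
would bound `G x u = x` (`DefinablyComplete.exists_bound`), which is absurd.

So at some height `y₀` there is, at every scale, an `x` with oscillation at least `u`. Compactness
excludes this for bounded `x`, so the least size of such an `x`, as a function of the scale, is
monotone and tends to infinity as the scale shrinks. Local o-minimality makes this function strictly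
monotone near its singularity (`LocallyOMinimal.exists_strictMonoOn`), then onto an unbounded
interval (`LocallyOMinimal.exists_image_eq_Ioi`): this is the homeomorphism.

Pulling a definable set back along it carries local o-minimality to neighbourhoods of infinity.
Archimedeanity handles the remaining bounded segment, whence o-minimality. -/

namespace LocOMin

open Set

/-! ### Closure properties of definable predicates and functions. -/

section Combinators

variable {L : FirstOrder.Language.{u, v}} {M : Type w} [L.Structure M] {n : ℕ}

/-- Definability, with arbitrary parameters, of a predicate on `Mⁿ`. -/
def DefPred (L : FirstOrder.Language.{u, v}) {M : Type w} [L.Structure M] {n : ℕ}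
    (p : (Fin n → M) → Prop) : Prop :=
  (univ : Set M).Definable L {v | p v}

/-- Definability, with arbitrary parameters, of a total function `Mⁿ → M`. -/
def DefTerm (L : FirstOrder.Language.{u, v}) {M : Type w} [L.Structure M] {n : ℕ}
    (f : (Fin n → M) → M) : Prop :=
  (univ : Set M).DefinableFun L f

theorem DefPred.and {p q : (Fin n → M) → Prop} (hp : DefPred L p) (hq : DefPred L q) :
    DefPred L fun v => p v ∧ q v :=
  Definable.inter hp hq

theorem DefPred.or {p q : (Fin n → M) → Prop} (hp : DefPred L p) (hq : DefPred L q) :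
    DefPred L fun v => p v ∨ q v :=
  Definable.union hp hq

theorem DefPred.not {p : (Fin n → M) → Prop} (hp : DefPred L p) : DefPred L fun v => ¬ p v :=
  Definable.compl hp

theorem DefPred.congr {p q : (Fin n → M) → Prop} (hp : DefPred L p) (h : ∀ v, p v ↔ q v) :
    DefPred L q := by
  rwa [show q = p from funext fun v => propext (h v).symm]

theorem DefPred.imp {p q : (Fin n → M) → Prop} (hp : DefPred L p) (hq : DefPred L q) :
    DefPred L fun v => p v → q v :=
  (hp.not.or hq).congr fun _ => imp_iff_not_or.symm

/-- Quantification is projection: the bound variable is coordinate `0` and the free ones are shifted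
by `Fin.succ`. -/
theorem DefPred.ex {p : (Fin n → M) → M → Prop}
    (hp : DefPred L fun v : Fin (n + 1) → M => p (fun i => v i.succ) (v 0)) :
    DefPred L fun v => ∃ x, p v x := by
  have h := Definable.image_comp hp (Fin.succ : Fin n → Fin (n + 1))
  refine DefPred.congr
    (p := (· ∈ (fun g : Fin (n + 1) → M => g ∘ Fin.succ) '' {v | p (fun i => v i.succ) (v 0)}))
    h fun v => ?_
  simp only [mem_image, mem_ofPred_eq]
  constructor
  · rintro ⟨w, hw, rfl⟩
    exact ⟨w 0, hw⟩
  · rintro ⟨x, hx⟩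
    exact ⟨Fin.cons x v, by simpa using hx, by ext; simp⟩

theorem DefPred.all {p : (Fin n → M) → M → Prop}
    (hp : DefPred L fun v : Fin (n + 1) → M => p (fun i => v i.succ) (v 0)) :
    DefPred L fun v => ∀ x, p v x :=
  (DefPred.ex (p := fun v x => ¬ p v x) hp.not).not.congr fun v => by simp

theorem DefPred.const (P : Prop) : DefPred L fun _ : Fin n → M => P := by
  by_cases h : P
  · simp [DefPred, h]
  · simp [DefPred, h]

theorem DefTerm.var (i : Fin n) : DefTerm L fun v : Fin n → M => v i :=
  DefinableFun.proj L

theorem DefTerm.const (c : M) : DefTerm L fun _ : Fin n → M => c :=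
  L.definableFun_const _ (mem_univ c)

theorem DefPred.subst {m : ℕ} {p : (Fin m → M) → Prop} (hp : DefPred L p)
    {f : Fin m → (Fin n → M) → M} (hf : ∀ i, DefTerm L (f i)) :
    DefPred L fun v => p fun i => f i v :=
  Definable.preimage_map (F := fun v i => f i v) (fun i => hf i) hp

theorem DefTerm.subst {m : ℕ} {g : (Fin m → M) → M} (hg : DefTerm L g)
    {f : Fin m → (Fin n → M) → M} (hf : ∀ i, DefTerm L (f i)) :
    DefTerm L fun v => g fun i => f i v :=
  DefinableFun.comp (g := fun v i => f i v) (fun i => hf i) hg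

theorem DefPred.eq {f g : (Fin n → M) → M} (hf : DefTerm L f) (hg : DefTerm L g) :
    DefPred L fun v => f v = g v :=
  DefinableFun.ofPred_eq hf hg

/-- A function is definable if its graph is. -/
theorem DefTerm.of_graph {f : (Fin n → M) → M}
    (h : DefPred L fun v : Fin (n + 1) → M => v 0 = f fun i => v i.succ) : DefTerm L f := by
  -- `Function.tupleGraph` has coordinates in `Option (Fin n)`, with the value at `none`; this
  -- reindexing sends coordinate `0` there.
  have := Definable.preimage_comp
    (fun i : Fin (n + 1) => (Fin.cons none some : Fin (n + 1) → Option (Fin n)) i) h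
  refine (congrArg (Definable univ L) (Set.ext fun v => ?_)).mp this
  simp only [mem_preimage, mem_ofPred_eq, Function.tupleGraph, Function.comp_def, Fin.cons_zero,
    Fin.cons_succ]
  exact eq_comm

theorem DefPred.subst₁ {p : M → Prop} (hp : DefPred L fun v : Fin 1 → M => p (v 0))
    {f : (Fin n → M) → M} (hf : DefTerm L f) : DefPred L fun v => p (f v) :=
  hp.subst (f := fun _ => f) fun _ => hf

theorem DefPred.subst₂ {p : M → M → Prop} (hp : DefPred L fun v : Fin 2 → M => p (v 0) (v 1))
    {f g : (Fin n → M) → M} (hf : DefTerm L f) (hg : DefTerm L g) :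
    DefPred L fun v => p (f v) (g v) :=
  hp.subst (f := ![f, g]) (by intro i; fin_cases i <;> assumption)

theorem DefTerm.subst₁ {p : M → M} (hp : DefTerm L fun v : Fin 1 → M => p (v 0))
    {f : (Fin n → M) → M} (hf : DefTerm L f) : DefTerm L fun v => p (f v) :=
  hp.subst (f := fun _ => f) fun _ => hf

theorem DefTerm.subst₂ {p : M → M → M} (hp : DefTerm L fun v : Fin 2 → M => p (v 0) (v 1))
    {f g : (Fin n → M) → M} (hf : DefTerm L f) (hg : DefTerm L g) :
    DefTerm L fun v => p (f v) (g v) :=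
  hp.subst (f := ![f, g]) (by intro i; fin_cases i <;> assumption)

end Combinators

/-! ### Definability of the order and the group operations. -/

section OrderedGroup

open FirstOrder FirstOrder.Language

variable {L : FirstOrder.Language.{u, v}} {M : Type w} [L.Structure M] {n : ℕ}
  [LinearOrder M] [AddCommGroup M]

theorem IsExpansionOfOrderedGroup.lt (hE : IsExpansionOfOrderedGroup L M)
    {f g : (Fin n → M) → M} (hf : DefTerm L f) (hg : DefTerm L g) :
    DefPred L fun v => f v < g v := by
  obtain ⟨r, hr⟩ := hE.exists_lt
  have h : DefPred L fun v : Fin 2 → M => v 0 < v 1 := by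
    refine Definable.mono (empty_definable_iff.2 ⟨r.formula (fun i => Term.var i), ?_⟩)
      (empty_subset _)
    ext v
    simp [Formula.realize_rel, hr]
  exact h.subst₂ hf hg

theorem IsExpansionOfOrderedGroup.le (hE : IsExpansionOfOrderedGroup L M)
    {f g : (Fin n → M) → M} (hf : DefTerm L f) (hg : DefTerm L g) :
    DefPred L fun v => f v ≤ g v :=
  (hE.lt hg hf).not.congr fun _ => not_lt

theorem IsExpansionOfOrderedGroup.add (hE : IsExpansionOfOrderedGroup L M)
    {f g : (Fin n → M) → M} (hf : DefTerm L f) (hg : DefTerm L g) :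
    DefTerm L fun v => f v + g v := by
  obtain ⟨r, hr⟩ := hE.exists_add
  have h : DefTerm L fun v : Fin 2 → M => v 0 + v 1 := by
    have := (DefinableFun.fun_symbol (M := M) r).of_empty (A := univ)
    rwa [show Structure.funMap r = fun v : Fin 2 → M => v 0 + v 1 from funext hr] at this
  exact h.subst₂ hf hg

theorem IsExpansionOfOrderedGroup.neg (hE : IsExpansionOfOrderedGroup L M)
    {f : (Fin n → M) → M} (hf : DefTerm L f) : DefTerm L fun v => - f v := by
  have h : DefTerm L fun v : Fin 1 → M => - v 0 :=
    DefTerm.of_graph ((DefPred.eq (hE.add (.var 0) (.var 1)) (.const 0)).congr fun v => by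
      simp [add_eq_zero_iff_eq_neg])
  exact h.subst₁ hf

theorem IsExpansionOfOrderedGroup.sub (hE : IsExpansionOfOrderedGroup L M)
    {f g : (Fin n → M) → M} (hf : DefTerm L f) (hg : DefTerm L g) :
    DefTerm L fun v => f v - g v := by
  simpa only [sub_eq_add_neg] using hE.add hf (hE.neg hg)

theorem IsExpansionOfOrderedGroup.abs_le [IsOrderedAddMonoid M]
    (hE : IsExpansionOfOrderedGroup L M)
    {f g : (Fin n → M) → M} (hf : DefTerm L f) (hg : DefTerm L g) :
    DefPred L fun v => |f v| ≤ g v :=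
  ((hE.le (hE.neg hg) hf).and (hE.le hf hg)).congr fun _ => _root_.abs_le.symm

theorem IsExpansionOfOrderedGroup.abs_lt [IsOrderedAddMonoid M]
    (hE : IsExpansionOfOrderedGroup L M)
    {f g : (Fin n → M) → M} (hf : DefTerm L f) (hg : DefTerm L g) :
    DefPred L fun v => |f v| < g v :=
  ((hE.lt (hE.neg hg) hf).and (hE.lt hf hg)).congr fun _ => _root_.abs_lt.symm

end OrderedGroup
-- Definable compactness of closed bounded intervals.
section Compactness

variable {L : FirstOrder.Language.{u, v}} {M : Type w} [L.Structure M]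
  [LinearOrder M]

theorem DefinablyComplete.exists_isLUB (hC : DefinablyComplete L M) {p : M → Prop}
    (hp : DefPred L fun v : Fin 1 → M => p (v 0)) {a b : M} (ha : p a) (hb : ∀ x, p x → x ≤ b) :
    ∃ s, IsLUB {x | p x} s :=
  (hC {x | p x} hp ⟨a, ha⟩).1 ⟨b, hb⟩

theorem DefinablyComplete.exists_isGLB (hC : DefinablyComplete L M) {p : M → Prop}
    (hp : DefPred L fun v : Fin 1 → M => p (v 0)) {a b : M} (ha : p a) (hb : ∀ x, p x → b ≤ x) :
    ∃ s, IsGLB {x | p x} s :=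
  (hC {x | p x} hp ⟨a, ha⟩).2 ⟨b, hb⟩

variable [AddCommGroup M] [IsOrderedAddMonoid M] [DenselyOrdered M]

/-- A definable form of the Heine-Borel property: a definable condition that holds locally
uniformly on `[a, b]` holds uniformly there. -/
theorem DefinablyComplete.exists_uniform (hC : DefinablyComplete L M)
    (hE : IsExpansionOfOrderedGroup L M) {P : M → M → Prop}
    (hP : DefPred L fun v : Fin 2 → M => P (v 0) (v 1))
    (anti : ∀ x e e', e' ≤ e → P x e → P x e') {a b : M}
    (hloc : ∀ x, a ≤ x → x ≤ b → ∃ e > 0, ∀ x', |x' - x| < e → P x' e) :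
    ∃ e > 0, ∀ x, a ≤ x → x ≤ b → P x e := by
  rcases le_or_gt a b with hab | hab
  swap
  · obtain ⟨e, he, -⟩ : ∃ e : M, 0 < e ∧ True := ⟨a - b, sub_pos.2 hab, trivial⟩
    exact ⟨e, he, fun x h1 h2 => absurd (h1.trans h2) hab.not_ge⟩
  -- A single `e` serves all of `[a, x]`. The supremum `s` of such `x` must be `b`: by `key`, the
  -- local bound at `s` extends the property beyond `s`.
  let p : M → Prop := fun x => a ≤ x ∧ x ≤ b ∧ ∃ e, 0 < e ∧ ∀ x', a ≤ x' → x' ≤ x → P x' e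
  have hp : DefPred L fun v : Fin 1 → M => p (v 0) := by
    apply_rules [DefPred.and, DefPred.ex, DefPred.all, DefPred.imp, hE.le, hE.lt, DefTerm.var,
      DefTerm.const, hP.subst₂]
  have pa : p a := by
    obtain ⟨e, he, h⟩ := hloc a le_rfl hab
    exact ⟨le_rfl, hab, e, he, fun x' h1 h2 => h x' (by simpa [le_antisymm h2 h1] using he)⟩
  obtain ⟨s, hs⟩ := hC.exists_isLUB hp pa (fun x hx => hx.2.1)
  have has : a ≤ s := hs.1 pa
  have hsb : s ≤ b := hs.2 fun x hx => hx.2.1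
  obtain ⟨e, he, h⟩ := hloc s has hsb
  obtain ⟨t, ht, h1, h2⟩ := hs.exists_between (sub_lt_self s he)
  obtain ⟨-, -, e', he', h'⟩ := ht
  have key : ∀ x, a ≤ x → x ≤ b → x < s + e → p x := fun x hx hxb hxs =>
    ⟨hx, hxb, min e e', lt_min he he', fun x' hx' hx'' => by
      rcases le_or_gt x' t with h3 | h3
      · exact anti _ _ _ (min_le_right _ _) (h' x' hx' h3)
      · refine anti _ _ _ (min_le_left _ _) (h x' (abs_lt.2 ⟨?_, ?_⟩))
        · grind
        · exact sub_lt_iff_lt_add'.2 (hx''.trans_lt hxs)⟩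
  have hsb' : s = b := by
    by_contra hne
    obtain ⟨x, hx1, hx2⟩ :=
      exists_between (lt_min (lt_of_le_of_ne hsb hne) (lt_add_of_pos_right s he))
    exact hx1.not_ge (hs.1 (key x (has.trans hx1.le) (hx2.le.trans (min_le_left _ _))
      (hx2.trans_le (min_le_right _ _))))
  obtain ⟨-, -, e, he, h⟩ := key b hab le_rfl (hsb' ▸ lt_add_of_pos_right s he)
  exact ⟨e, he, h⟩

end Compactness

/-! ### Finite unions of points and intervals. -/

section FiniteUnions

variable {M : Type w} [LinearOrder M]

theorem isFiniteUnion_empty : IsFiniteUnionOfPointsAndIntervals (∅ : Set M) :=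
  ⟨∅, finite_empty, by simp, by simp⟩

theorem isFiniteUnion_singleton (x : M) : IsFiniteUnionOfPointsAndIntervals {x} :=
  ⟨{{x}}, finite_singleton _, by simp, by simp⟩

theorem IsOpenInterval.isFiniteUnion {I : Set M} (h : IsOpenInterval I) :
    IsFiniteUnionOfPointsAndIntervals I :=
  ⟨{I}, finite_singleton _, by simp [h], by simp⟩

theorem isFiniteUnion_Ioo (a b : M) : IsFiniteUnionOfPointsAndIntervals (Ioo a b) := by
  rcases lt_or_ge a b with h | h
  · exact IsOpenInterval.isFiniteUnion (.inl ⟨a, b, h, rfl⟩)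
  · rw [Ioo_eq_empty h.not_gt]; exact isFiniteUnion_empty

theorem IsFiniteUnionOfPointsAndIntervals.union {X Y : Set M}
    (hX : IsFiniteUnionOfPointsAndIntervals X) (hY : IsFiniteUnionOfPointsAndIntervals Y) :
    IsFiniteUnionOfPointsAndIntervals (X ∪ Y) := by
  obtain ⟨S, hS, hS', rfl⟩ := hX
  obtain ⟨T, hT, hT', rfl⟩ := hY
  exact ⟨S ∪ T, hS.union hT, fun s hs => hs.elim (hS' s) (hT' s), (sUnion_union S T).symm⟩

theorem isFiniteUnion_inter_of_subset {X I : Set M} (hI : IsFiniteUnionOfPointsAndIntervals I)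
    (h : I ⊆ X ∨ I ⊆ Xᶜ) : IsFiniteUnionOfPointsAndIntervals (X ∩ I) := by
  rcases h with h | h
  · rwa [inter_eq_right.2 h]
  · rw [(disjoint_right.2 h).inter_eq]
    exact isFiniteUnion_empty

theorem isFiniteUnion_inter_singleton (X : Set M) (x : M) :
    IsFiniteUnionOfPointsAndIntervals (X ∩ {x}) :=
  isFiniteUnion_inter_of_subset (isFiniteUnion_singleton x)
    (by by_cases h : x ∈ X <;> simp [h])

theorem IsOpenInterval.exists_Ioo_subset [DenselyOrdered M] [NoMinOrder M] [NoMaxOrder M]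
    [Nonempty M] {I : Set M} (h : IsOpenInterval I) : ∃ a b, a < b ∧ Ioo a b ⊆ I := by
  rcases h with ⟨a, b, hab, rfl⟩ | ⟨a, rfl⟩ | ⟨b, rfl⟩ | rfl
  · exact ⟨a, b, hab, Subset.rfl⟩
  · obtain ⟨b, hb⟩ := exists_gt a
    exact ⟨a, b, hb, fun _ h => h.1⟩
  · obtain ⟨a, ha⟩ := exists_lt b
    exact ⟨a, b, ha, fun _ h => h.2⟩
  · obtain ⟨b, hb⟩ := exists_gt (Classical.arbitrary M)
    exact ⟨_, b, hb, subset_univ _⟩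

/-- An infinite finite union of points and intervals contains an interval. -/
theorem IsFiniteUnionOfPointsAndIntervals.exists_Ioo_subset [DenselyOrdered M] [NoMinOrder M]
    [NoMaxOrder M] [Nonempty M] {X : Set M} (hX : IsFiniteUnionOfPointsAndIntervals X)
    (hinf : X.Infinite) : ∃ a b, a < b ∧ Ioo a b ⊆ X := by
  obtain ⟨S, hS, hS', rfl⟩ := hX
  by_contra hcon
  refine hinf (hS.sUnion fun s hs => ?_)
  rcases hS' s hs with ⟨x, rfl⟩ | h
  · exact finite_singleton x
  · obtain ⟨a, b, hab, h⟩ := h.exists_Ioo_subset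
    exact absurd ⟨a, b, hab, h.trans (subset_sUnion_of_mem hs)⟩ hcon

theorem IsFiniteUnionOfPointsAndIntervals.germ_left [NoMinOrder M] {X : Set M}
    (hX : IsFiniteUnionOfPointsAndIntervals X) (a : M) :
    ∃ b < a, Ioo b a ⊆ X ∨ Ioo b a ⊆ Xᶜ := by
  obtain ⟨S, hS, hS', rfl⟩ := hX
  induction S, hS using Set.Finite.induction_on with
  | empty =>
    obtain ⟨b, hb⟩ := exists_lt a
    exact ⟨b, hb, .inr (by simp)⟩
  | @insert s S _ _ ih =>
    obtain ⟨b, hb, h⟩ := ih fun t ht => hS' t (mem_insert_of_mem _ ht)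
    obtain ⟨c, hc, h'⟩ : ∃ c < a, Ioo c a ⊆ s ∨ Ioo c a ⊆ sᶜ := by
      obtain ⟨d, hd⟩ := exists_lt a
      rcases hS' s (mem_insert _ _) with ⟨x, rfl⟩ | ⟨p, q, -, rfl⟩ | ⟨p, rfl⟩ | ⟨q, rfl⟩ | rfl
      · rcases lt_or_ge x a with h | h
        · exact ⟨x, h, .inr fun y hy => hy.1.ne'⟩
        · exact ⟨d, hd, .inr fun y hy => (hy.2.trans_le h).ne⟩
      · rcases le_or_gt a p with h | h
        · exact ⟨d, hd, .inr fun y hy hy' => (hy.2.trans_le h).not_gt hy'.1⟩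
        · rcases le_or_gt a q with h' | h'
          · exact ⟨p, h, .inl fun y hy => ⟨hy.1, hy.2.trans_le h'⟩⟩
          · exact ⟨q, h', .inr fun y hy hy' => hy.1.not_gt hy'.2⟩
      · rcases le_or_gt a p with h | h
        · exact ⟨d, hd, .inr fun y hy hy' => (hy.2.trans_le h).not_gt hy'⟩
        · exact ⟨p, h, .inl fun y hy => hy.1⟩
      · rcases le_or_gt a q with h' | h'
        · exact ⟨d, hd, .inl fun y hy => hy.2.trans_le h'⟩
        · exact ⟨q, h', .inr fun y hy hy' => hy.1.not_gt hy'⟩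
      · exact ⟨d, hd, .inl (subset_univ _)⟩
    refine ⟨max b c, max_lt hb hc, ?_⟩
    have hb' : Ioo (max b c) a ⊆ Ioo b a := Ioo_subset_Ioo_left (le_max_left _ _)
    have hc' : Ioo (max b c) a ⊆ Ioo c a := Ioo_subset_Ioo_left (le_max_right _ _)
    rw [sUnion_insert, compl_union]
    rcases h' with h' | h'
    · exact .inl ((hc'.trans h').trans subset_union_left)
    · rcases h with h | h
      · exact .inl ((hb'.trans h).trans subset_union_right)
      · exact .inr (subset_inter (hc'.trans h') (hb'.trans h))

theorem IsOpenInterval.exists_Ioo_left_subset [NoMinOrder M] {I : Set M} (h : IsOpenInterval I)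
    {a : M} (ha : a ∈ I) : ∃ b < a, Ioo b a ⊆ I := by
  obtain ⟨d, hd⟩ := exists_lt a
  rcases h with ⟨p, q, -, rfl⟩ | ⟨p, rfl⟩ | ⟨q, rfl⟩ | rfl
  · exact ⟨p, ha.1, Ioo_subset_Ioo_right ha.2.le⟩
  · exact ⟨p, ha, fun _ h => h.1⟩
  · exact ⟨d, hd, fun _ h => h.2.trans ha⟩
  · exact ⟨d, hd, subset_univ _⟩

end FiniteUnions

/-! ### One-sided germs, and tameness on bounded segments. -/

section Germs

variable {L : FirstOrder.Language.{u, v}} {M : Type w} [L.Structure M]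
  [LinearOrder M]

theorem LocallyOMinimal.germ_left [NoMinOrder M] (hO : LocallyOMinimal L M) {p : M → Prop}
    (hp : DefPred L fun v : Fin 1 → M => p (v 0)) (a : M) :
    ∃ b < a, (∀ x, b < x → x < a → p x) ∨ ∀ x, b < x → x < a → ¬ p x := by
  obtain ⟨I, hI, haI, h⟩ := hO {x | p x} hp a
  obtain ⟨b, hb, hbI⟩ := hI.exists_Ioo_left_subset haI
  obtain ⟨c, hc, h⟩ := h.germ_left a
  have hb' : Ioo (max b c) a ⊆ Ioo b a := Ioo_subset_Ioo_left (le_max_left _ _)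
  have hc' : Ioo (max b c) a ⊆ Ioo c a := Ioo_subset_Ioo_left (le_max_right _ _)
  refine ⟨max b c, max_lt hb hc, h.imp (fun h x h1 h2 => ?_) fun h x h1 h2 h3 => ?_⟩
  · exact (h (hc' ⟨h1, h2⟩)).1
  · exact h (hc' ⟨h1, h2⟩) ⟨h3, hbI (hb' ⟨h1, h2⟩)⟩

variable [AddCommGroup M] [IsOrderedAddMonoid M]

theorem LocallyOMinimal.germ_right [NoMinOrder M] (hO : LocallyOMinimal L M)
    (hE : IsExpansionOfOrderedGroup L M) {p : M → Prop}
    (hp : DefPred L fun v : Fin 1 → M => p (v 0)) (a : M) :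
    ∃ b > a, (∀ x, a < x → x < b → p x) ∨ ∀ x, a < x → x < b → ¬ p x := by
  obtain ⟨b, hb, h⟩ := hO.germ_left (p := fun x => p (-x)) (hp.subst₁ (hE.neg (.var 0))) (-a)
  refine ⟨-b, lt_neg.1 hb, h.imp (fun h x h1 h2 => ?_) fun h x h1 h2 => ?_⟩ <;>
    simpa using h (-x) (lt_neg.1 h2) (neg_lt_neg h1)

/-- One-sided germs cut a short segment at a single point; compactness makes the length uniform, and
archimedeanity covers `[a, b]` by finitely many such segments. The right end `c` may overshoot `b`,
so the last segment needs no trimming. -/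
theorem LocallyOMinimal.exists_isFiniteUnion_inter_Icc [DenselyOrdered M] [Nontrivial M]
    (hO : LocallyOMinimal L M) (hC : DefinablyComplete L M)
    (hE : IsExpansionOfOrderedGroup L M) (hA : Archimedean M) {X : Set M}
    (hX : DefPred L fun v : Fin 1 → M => v 0 ∈ X) (a b : M) :
    ∃ c ≥ b, IsFiniteUnionOfPointsAndIntervals (X ∩ Icc a c) := by
  -- The cut point `d` leaves membership in `X` constant on either side within `[x, x + e]`. The
  -- guard `0 ≤ e` makes `P` hold vacuously for negative `e`, as downward closure in `e` requires.
  let P : M → M → Prop := fun x e => 0 ≤ e → ∃ d, x ≤ d ∧ d ≤ x + e ∧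
    ((∀ z, x < z → z < d → z ∈ X) ∨ ∀ z, x < z → z < d → z ∉ X) ∧
    ((∀ z, d < z → z < x + e → z ∈ X) ∨ ∀ z, d < z → z < x + e → z ∉ X)
  have hP : DefPred L fun v : Fin 2 → M => P (v 0) (v 1) := by
    apply_rules (maxDepth := 200) [DefPred.and, DefPred.or, DefPred.ex, DefPred.all,
      DefPred.imp, hE.le, hE.lt, DefTerm.var, DefTerm.const, hE.add, DefPred.const, hX.subst₁]
  obtain ⟨e, he, h⟩ := hC.exists_uniform hE hP (a := a) (b := b)
    (fun x e e' hee h he' => by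
      obtain ⟨d, h1, h2, h3, h4⟩ := h (he'.trans hee)
      refine ⟨min d (x + e'), le_min h1 (le_add_of_nonneg_right he'), min_le_right _ _, ?_, ?_⟩
      · exact h3.imp (fun h z hz hz' => h z hz (hz'.trans_le (min_le_left _ _)))
          (fun h z hz hz' => h z hz (hz'.trans_le (min_le_left _ _)))
      · have aux : ∀ z, min d (x + e') < z → z < x + e' → d < z := fun z h1 h2 =>
          (min_lt_iff.1 h1).resolve_right h2.not_gt
        have hle : x + e' ≤ x + e := by gcongr
        exact h4.imp (fun h z hz hz' => h z (aux z hz hz') (hz'.trans_le hle))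
          (fun h z hz hz' => h z (aux z hz hz') (hz'.trans_le hle)))
    (fun x _ _ => by
      obtain ⟨l, hl, h1⟩ := hO.germ_left hX x
      obtain ⟨r, hr, h2⟩ := hO.germ_right hE hX x
      obtain ⟨e, he, hlt⟩ := exists_between (sub_pos.2 hr)
      obtain ⟨e', he', hlt'⟩ := exists_between (lt_min he (lt_min (sub_pos.2 hl)
        (sub_pos.2 hlt)))
      simp only [lt_min_iff] at hlt'
      obtain ⟨h3, h4, h5⟩ := hlt'
      refine ⟨e', he', fun x' hx' _ => ?_⟩
      rw [abs_lt] at hx'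
      have b1 : l < x' := by grind
      have b2 : x' + e' < r := by grind
      -- The cut is `x` clamped to `[x', x' + e']`: only at `x` can membership change there.
      refine ⟨max x' (min x (x' + e')), le_max_left _ _,
        max_le (le_add_of_nonneg_right he'.le) (min_le_right _ _), ?_, ?_⟩
      · have aux : ∀ z, x' < z → z < max x' (min x (x' + e')) → z < x := fun z h1 h2 =>
          lt_of_lt_of_le ((lt_max_iff.1 h2).resolve_left h1.not_gt) (min_le_left _ _)
        exact h1.imp (fun h z hz hz' => h z (b1.trans hz) (aux z hz hz'))
          (fun h z hz hz' => h z (b1.trans hz) (aux z hz hz'))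
      · have aux : ∀ z, max x' (min x (x' + e')) < z → z < x' + e' → x < z := fun z h1 h2 =>
          (min_lt_iff.1 (max_lt_iff.1 h1).2).resolve_right h2.not_gt
        exact h2.imp (fun h z hz hz' => h z (aux z hz hz') (hz'.trans b2))
          (fun h z hz hz' => h z (aux z hz hz') (hz'.trans b2)))
  have step : ∀ x, a ≤ x → x ≤ b →
      IsFiniteUnionOfPointsAndIntervals (X ∩ Icc x (x + e)) := fun x hx hx' => by
    obtain ⟨d, h1, h2, h3, h4⟩ := h x hx hx' he.le
    have : Icc x (x + e) = {x} ∪ Ioo x d ∪ {d} ∪ Ioo d (x + e) ∪ {x + e} := by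
      ext z
      simp only [mem_Icc, mem_union, mem_singleton_iff, mem_Ioo]
      grind
    rw [this]
    simp only [inter_union_distrib_left]
    refine ((((isFiniteUnion_inter_singleton _ _).union ?_).union
      (isFiniteUnion_inter_singleton _ _)).union ?_).union (isFiniteUnion_inter_singleton _ _)
    · exact isFiniteUnion_inter_of_subset (isFiniteUnion_Ioo _ _)
        (h3.imp (fun h z hz => h z hz.1 hz.2) fun h z hz => h z hz.1 hz.2)
    · exact isFiniteUnion_inter_of_subset (isFiniteUnion_Ioo _ _)
        (h4.imp (fun h z hz => h z hz.1 hz.2) fun h z hz => h z hz.1 hz.2)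
  have main : ∀ n : ℕ, ∃ c, (b ≤ c ∨ c = a + n • e) ∧ a ≤ c ∧
      IsFiniteUnionOfPointsAndIntervals (X ∩ Icc a c) := fun n => by
    induction n with
    | zero => exact ⟨a, by simp, le_rfl, by simpa using isFiniteUnion_inter_singleton X a⟩
    | succ n ih =>
      obtain ⟨c, hc, hac, hU⟩ := ih
      rcases le_or_gt b c with hbc | hbc
      · exact ⟨c, .inl hbc, hac, hU⟩
      · have hce : c ≤ c + e := le_add_of_nonneg_right he.le
        refine ⟨c + e, .inr ?_, hac.trans hce, ?_⟩
        · rw [hc.resolve_left hbc.not_ge, succ_nsmul, add_assoc]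
        · rw [← Icc_union_Icc_eq_Icc hac hce, inter_union_distrib_left]
          exact hU.union (step c hac hbc.le)
  obtain ⟨n, hn⟩ := hA.arch (b - a) he
  obtain ⟨c, hc, -, hU⟩ := main n
  exact ⟨c, hc.elim id fun h => by rw [h]; exact sub_le_iff_le_add'.1 hn, hU⟩

/-- An infinite bounded definable set contains an interval. -/
theorem LocallyOMinimal.exists_Ioo_subset_of_infinite [DenselyOrdered M] [Nontrivial M]
    (hO : LocallyOMinimal L M) (hC : DefinablyComplete L M)
    (hE : IsExpansionOfOrderedGroup L M) (hA : Archimedean M) {X : Set M}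
    (hX : DefPred L fun v : Fin 1 → M => v 0 ∈ X) {a b : M} (hab : X ⊆ Icc a b)
    (hinf : X.Infinite) : ∃ p q, p < q ∧ Ioo p q ⊆ X := by
  obtain ⟨c, hc, h⟩ := hO.exists_isFiniteUnion_inter_Icc hC hE hA hX a b
  rw [inter_eq_left.2 (hab.trans (Icc_subset_Icc_right hc))] at h
  exact h.exists_Ioo_subset hinf

end Germs
-- From a family escaping to infinity to a strictly monotone map onto an unbounded interval.
section UnboundedGerm

variable {L : FirstOrder.Language.{u, v}} {M : Type w} [L.Structure M]
  [LinearOrder M] [AddCommGroup M]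

/-- The infimum of a definable family of sets, as a definable function of the parameter. -/
theorem DefinablyComplete.exists_inf_fun (hC : DefinablyComplete L M)
    (hE : IsExpansionOfOrderedGroup L M) {Q : M → M → Prop}
    (hQ : DefPred L fun v : Fin 2 → M => Q (v 0) (v 1))
    (hne : ∀ t < 0, ∃ r, Q t r) (hlow : ∀ t < 0, ∀ r, Q t r → 0 ≤ r) :
    ∃ h : M → M, (DefTerm L fun v : Fin 1 → M => h (v 0)) ∧ ∀ t < 0, IsGLB {r | Q t r} (h t) := by
  classical
  have ex : ∀ t, t < 0 → ∃ s, IsGLB {r | Q t r} s := fun t ht => by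
    obtain ⟨r, hr⟩ := hne t ht
    exact hC.exists_isGLB (hQ.subst₂ (.const t) (.var 0)) hr (hlow t ht)
  choose! h hh using ex
  -- The value `0` off the negative half-line makes the function total and keeps it definable.
  let h' : M → M := fun t => if t < 0 then h t else 0
  let P : M → M → Prop := fun t y => (t < 0 ∧ (∀ r, Q t r → y ≤ r) ∧
    ∀ z, (∀ r, Q t r → z ≤ r) → z ≤ y) ∨ 0 ≤ t ∧ y = 0
  have hP : DefPred L fun v : Fin 2 → M => P (v 1) (v 0) := by
    apply_rules (maxDepth := 200) [DefPred.and, DefPred.or, DefPred.ex, DefPred.all, DefPred.imp,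
      hE.le, hE.lt, DefTerm.var, DefTerm.const, hE.add, hQ.subst₂, DefPred.eq]
  refine ⟨h', DefTerm.of_graph (hP.congr fun v => ?_), fun t ht => by
    simpa only [h', if_pos ht] using hh t ht⟩
  change P (v 1) (v 0) ↔ v 0 = h' (v 1)
  rcases lt_or_ge (v 1) 0 with ht | ht
  · simp only [P, h', ht, ht.not_ge, if_true, true_and, false_and, or_false]
    exact ⟨fun h => IsGLB.unique (s := {r | Q (v 1) r})
      ⟨fun r hr => h.1 r hr, fun z hz => h.2 z fun r hr => hz hr⟩ (hh _ ht),
      fun e => e ▸ ⟨fun r hr => (hh _ ht).1 hr, fun z hz => (hh _ ht).2 fun r hr => hz r hr⟩⟩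
  · simp [P, h', ht, ht.not_gt]

variable [IsOrderedAddMonoid M] [DenselyOrdered M] [Nontrivial M]

/-- A definable function which is monotone on `]-∞,0[` and tends to `+∞` at `0` is strictly
monotone near `0`. -/
theorem LocallyOMinimal.exists_strictMonoOn (hO : LocallyOMinimal L M)
    (hC : DefinablyComplete L M) (hE : IsExpansionOfOrderedGroup L M) {h : M → M}
    (hh : DefTerm L fun v : Fin 1 → M => h (v 0)) (hmono : MonotoneOn h (Iio 0))
    (hinf : ∀ R, ∃ b < 0, ∀ t, b < t → t < 0 → R < h t) :
    ∃ b < 0, StrictMonoOn h (Ioo b 0) := by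
  -- By monotonicity, `p t` says that `h` is constant around `t`. If this held throughout a left
  -- neighbourhood of `0`, the level set of `t₀` would extend beyond its supremum, which is negative
  -- because `h` tends to infinity.
  let p : M → Prop := fun t => ∃ s₁ s₂, s₁ < t ∧ t < s₂ ∧ s₂ < 0 ∧ h s₁ = h s₂
  have hp : DefPred L fun v : Fin 1 → M => p (v 0) := by
    apply_rules (maxDepth := 200) [DefPred.and, DefPred.ex, hE.lt, DefTerm.var, DefTerm.const,
      hh.subst₁, DefPred.eq]
  obtain ⟨b, hb, h1 | h1⟩ := hO.germ_left hp 0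
  · exfalso
    obtain ⟨t₀, hbt, ht0⟩ := exists_between hb
    let q : M → Prop := fun t => t₀ ≤ t ∧ t < 0 ∧ h t = h t₀
    have hq : DefPred L fun v : Fin 1 → M => q (v 0) := by
      apply_rules (maxDepth := 200) [DefPred.and, hE.lt, hE.le, DefTerm.var, DefTerm.const,
        hh.subst₁, DefPred.eq]
    obtain ⟨d, hd, hd'⟩ := hinf (h t₀)
    have hub : ∀ x, q x → x ≤ d := fun x hx => by
      by_contra hlt
      exact (hd' x (not_le.1 hlt) hx.2.1).ne' hx.2.2
    have hq0 : q t₀ := ⟨le_rfl, ht0, rfl⟩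
    obtain ⟨s, hs⟩ := hC.exists_isLUB hq hq0 hub
    have hs0 : s < 0 := (hs.2 hub).trans_lt hd
    obtain ⟨s₁, s₂, h2, h3, h4, h5⟩ := h1 s (hbt.trans_le (hs.1 hq0)) hs0
    obtain ⟨t, ht, hst, hts⟩ := hs.exists_between h2
    have hts₂ := hts.trans_lt h3
    have h6 : h t = h s₂ := le_antisymm (hmono ht.2.1 h4 hts₂.le)
      (h5 ▸ hmono (hst.trans ht.2.1) ht.2.1 hst.le)
    exact h3.not_ge (hs.1 ⟨ht.1.trans hts₂.le, h4, h6.symm.trans ht.2.2⟩)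
  · refine ⟨b, hb, fun s hs t ht hst => lt_of_le_of_ne (hmono hs.2 ht.2 hst.le) fun heq => ?_⟩
    obtain ⟨r, h2, h3⟩ := exists_between hst
    exact h1 r (hs.1.trans h2) (h3.trans ht.2) ⟨s, t, h2, h3, ht.2, heq⟩

/-- A definable function which is strictly monotone on the left of `0` and tends to `+∞` there
maps a small interval onto an unbounded interval. -/
theorem LocallyOMinimal.exists_image_eq_Ioi (hO : LocallyOMinimal L M)
    (hC : DefinablyComplete L M) (hE : IsExpansionOfOrderedGroup L M) (hA : Archimedean M)
    {h : M → M} (hh : DefTerm L fun v : Fin 1 → M => h (v 0)) {a : M} (ha : a < 0)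
    (hmono : StrictMonoOn h (Ioo a 0))
    (hinf : ∀ R, ∃ b < 0, ∀ t, b < t → t < 0 → R < h t) :
    ∃ b, a < b ∧ b < 0 ∧ h '' Ioo b 0 = Ioi (h b) := by
  -- `p t` is an intermediate value property around `t`. If it holds near `0`, each `y > h b` is
  -- attained near the supremum of the points where `h` stays below `y`.
  let p : M → Prop := fun t => ∃ s₁ s₂, a < s₁ ∧ s₁ < t ∧ t < s₂ ∧ s₂ < 0 ∧
    ∀ y, h s₁ < y → y < h s₂ → ∃ s, s₁ < s ∧ s < s₂ ∧ h s = y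
  have hp : DefPred L fun v : Fin 1 → M => p (v 0) := by
    apply_rules (maxDepth := 200) [DefPred.and, DefPred.ex, DefPred.all, DefPred.imp, hE.lt,
      DefTerm.var, DefTerm.const, hh.subst₁, DefPred.eq]
  obtain ⟨c, hc, h1 | h1⟩ := hO.germ_left hp 0
  · obtain ⟨b, hb, hb0⟩ := exists_between (max_lt ha hc)
    rw [max_lt_iff] at hb
    refine ⟨b, hb.1, hb0, Subset.antisymm ?_ fun y (hy : h b < y) => ?_⟩
    · rintro _ ⟨t, ht, rfl⟩
      exact hmono ⟨hb.1, hb0⟩ ⟨hb.1.trans ht.1, ht.2⟩ ht.1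
    · let q : M → Prop := fun t => b ≤ t ∧ t < 0 ∧ h t < y
      have hq : DefPred L fun v : Fin 1 → M => q (v 0) := by
        apply_rules (maxDepth := 200) [DefPred.and, hE.lt, hE.le, DefTerm.var, DefTerm.const,
          hh.subst₁, DefPred.eq]
      obtain ⟨d, hd, hd'⟩ := hinf y
      have hub : ∀ x, q x → x ≤ d := fun x hx => by
        by_contra hlt
        exact (hd' x (not_le.1 hlt) hx.2.1).not_gt hx.2.2
      have hqb : q b := ⟨le_rfl, hb0, hy⟩
      obtain ⟨s, hs⟩ := hC.exists_isLUB hq hqb hub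
      have hs0 : s < 0 := (hs.2 hub).trans_lt hd
      have hbs : b ≤ s := hs.1 hqb
      obtain ⟨s₁, s₂, h2, h3, h4, h5, h6⟩ := h1 s (hb.2.trans_le hbs) hs0
      obtain ⟨t, ht, hst, hts⟩ := hs.exists_between h3
      have h7 : h s₁ < y :=
        (hmono ⟨h2, h3.trans hs0⟩ ⟨h2.trans hst, ht.2.1⟩ hst).trans ht.2.2
      have hbs₂ := hbs.trans_lt h4
      rcases lt_trichotomy y (h s₂) with h8 | h8 | h8
      · obtain ⟨z, hz, hz', rfl⟩ := h6 y h7 h8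
        have hz0 := hz'.trans h5
        refine ⟨z, ⟨?_, hz0⟩, rfl⟩
        by_contra hzb
        exact (hmono.monotoneOn ⟨h2.trans hz, hz0⟩ ⟨hb.1, hb0⟩ (not_lt.1 hzb)).not_gt hy
      · exact ⟨s₂, ⟨hbs₂, h5⟩, h8.symm⟩
      · exact absurd (hs.1 ⟨hbs₂.le, h5, h8⟩) h4.not_ge
  -- The image of a short interval is infinite, bounded and definable, so it contains an interval.
  -- Three values in it have preimages `t₁ < t₂ < t₃` that witness `p t₂`.
  · exfalso
    obtain ⟨s, hs, hs0⟩ := exists_between (max_lt ha hc)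
    obtain ⟨t, hst, ht0⟩ := exists_between hs0
    rw [max_lt_iff] at hs
    have hsub : Ioo s t ⊆ Ioo a 0 := Ioo_subset_Ioo hs.1.le ht0.le
    obtain ⟨x, y, hxy, hsub'⟩ := hO.exists_Ioo_subset_of_infinite hC hE hA
      (X := h '' Ioo s t) (a := h s) (b := h t)
      (by
        have : DefPred L fun v : Fin 1 → M => ∃ r, (s < r ∧ r < t) ∧ h r = v 0 := by
          apply_rules (maxDepth := 200) [DefPred.and, DefPred.ex, hE.lt, DefTerm.var,
            DefTerm.const, hh.subst₁, DefPred.eq]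
        exact this)
      (by
        rintro _ ⟨r, hr, rfl⟩
        exact ⟨(hmono ⟨hs.1, hs0⟩ (hsub hr) hr.1).le,
          (hmono (hsub hr) ⟨hs.1.trans hst, ht0⟩ hr.2).le⟩)
      ((Ioo_infinite hst).image (hmono.mono hsub).injOn)
    obtain ⟨y₂, h2, h2'⟩ := exists_between hxy
    obtain ⟨y₁, h3, h3'⟩ := exists_between h2
    obtain ⟨y₃, h4, h4'⟩ := exists_between h2'
    obtain ⟨t₂, ht₂, rfl⟩ := hsub' ⟨h2, h2'⟩
    obtain ⟨t₁, ht₁, rfl⟩ := hsub' ⟨h3, h3'.trans h2'⟩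
    obtain ⟨t₃, ht₃, rfl⟩ := hsub' ⟨h2.trans h4, h4'⟩
    have h12 := (hmono.lt_iff_lt (hsub ht₁) (hsub ht₂)).1 h3'
    have h23 := (hmono.lt_iff_lt (hsub ht₂) (hsub ht₃)).1 h4
    refine h1 t₂ (hs.2.trans ht₂.1) (hsub ht₂).2 ⟨t₁, t₃, (hsub ht₁).1, h12, h23, (hsub ht₃).2,
      fun z hz hz' => ?_⟩
    obtain ⟨r, hr, rfl⟩ := hsub' ⟨h3.trans hz, hz'.trans h4'⟩
    exact ⟨r, (hmono.lt_iff_lt (hsub ht₁) (hsub hr)).1 hz,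
      (hmono.lt_iff_lt (hsub hr) (hsub ht₃)).1 hz', rfl⟩

/-- A definable family of bounded below sets which escapes to `+∞` yields a definable strictly
monotone map of a bounded interval onto an unbounded one. -/
theorem LocallyOMinimal.exists_unbounded_strictMonoOn (hO : LocallyOMinimal L M)
    (hC : DefinablyComplete L M) (hE : IsExpansionOfOrderedGroup L M) (hA : Archimedean M)
    {Q : M → M → Prop} (hQ : DefPred L fun v : Fin 2 → M => Q (v 0) (v 1))
    (hne : ∀ t < 0, ∃ r, Q t r) (hlow : ∀ t < 0, ∀ r, Q t r → 0 ≤ r)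
    (anti : ∀ s t r, s ≤ t → Q t r → Q s r)
    (hinf : ∀ R, ∃ b < 0, ∀ t, b < t → t < 0 → ∀ r, Q t r → R < r) :
    ∃ (h : M → M) (b c : M), b < 0 ∧ (DefTerm L fun v : Fin 1 → M => h (v 0)) ∧
      StrictMonoOn h (Ioo b 0) ∧ h '' Ioo b 0 = Ioi c := by
  obtain ⟨h, hh, hGLB⟩ := hC.exists_inf_fun hE hQ hne hlow
  have hinf' : ∀ R, ∃ b < 0, ∀ t, b < t → t < 0 → R < h t := fun R => by
    obtain ⟨R', hR'⟩ := exists_gt R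
    obtain ⟨b, hb, hb'⟩ := hinf R'
    exact ⟨b, hb, fun t ht ht' => hR'.trans_le ((hGLB t ht').2 fun r hr => (hb' t ht ht' r hr).le)⟩
  obtain ⟨a, ha, hmono⟩ := hO.exists_strictMonoOn hC hE hh
    (fun s hs t ht hst => (hGLB t ht).2 fun r hr => (hGLB s hs).1 (anti s t r hst hr)) hinf'
  obtain ⟨b, hab, hb, him⟩ := hO.exists_image_eq_Ioi hC hE hA hh ha hmono hinf'
  exact ⟨h, b, h b, hb, hh, hmono.mono (Ioo_subset_Ioo_left hab.le), him⟩

end UnboundedGerm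

/-! ### The homeomorphism between intervals. -/

section Homeomorphism

variable {L : FirstOrder.Language.{u, v}} {M : Type w} [L.Structure M]
  [LinearOrder M] [AddCommGroup M] [TopologicalSpace M] [OrderTopology M]

/-- A definable strictly monotone map of a bounded interval onto an unbounded one is a
homeomorphism. -/
theorem hasBoundedUnboundedHomeo_of_image_eq_Ioi
    {h : M → M} {a b c : M} (hab : a < b) (hE : IsExpansionOfOrderedGroup L M)
    (hh : DefTerm L fun v : Fin 1 → M => h (v 0))
    (hmono : StrictMonoOn h (Ioo a b)) (him : h '' Ioo a b = Ioi c) :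
    HasBoundedUnboundedHomeo L M := by
  let g : Ioo a b → Ioi c := fun t => ⟨h t, him ▸ mem_image_of_mem h t.2⟩
  have hg : StrictMono g := fun s t hst => hmono s.2 t.2 hst
  have hs : Function.Surjective g := by
    rintro ⟨y, hy⟩
    rw [← him] at hy
    obtain ⟨t, ht, rfl⟩ := hy
    exact ⟨⟨t, ht⟩, rfl⟩
  -- Continuity both ways is automatic: an interval carries its own order topology, so an order
  -- isomorphism is a homeomorphism.
  refine ⟨Ioo a b, Ioi c, ⟨a, b, hab, rfl⟩, .inl ⟨c, rfl⟩,
    (hg.orderIsoOfSurjective g hs).toHomeomorph, .inl hg, ?_⟩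
  have : DefPred L fun v : Fin 2 → M => (a < v 0 ∧ v 0 < b) ∧ v 1 = h (v 0) := by
    apply_rules (maxDepth := 200) [DefPred.and, hE.lt, DefTerm.var, DefTerm.const, hh.subst₁,
      DefPred.eq]
  refine this.congr fun v => ?_
  simp only [mem_ofPred_eq, Prod.mk.injEq]
  constructor
  · rintro ⟨h1, h2⟩
    exact ⟨⟨v 0, h1⟩, rfl, h2⟩
  · rintro ⟨t, h1, h2⟩
    rw [h1, h2]
    exact ⟨t.2, rfl⟩

end Homeomorphism

/-! ### Germs at infinity and o-minimality. -/

section OMinimality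

variable {L : FirstOrder.Language.{u, v}} {M : Type w} [L.Structure M]
  [LinearOrder M] [AddCommGroup M] [IsOrderedAddMonoid M] [DenselyOrdered M] [Nontrivial M]

/-- In the presence of a definable strictly monotone map from a bounded interval onto an unbounded
one, local o-minimality transfers to neighbourhoods of `+∞`. -/
theorem LocallyOMinimal.germ_atTop (hO : LocallyOMinimal L M) {h : M → M} {b c : M} (hb : b < 0)
    (hh : DefTerm L fun v : Fin 1 → M => h (v 0)) (hmono : StrictMonoOn h (Ioo b 0))
    (him : h '' Ioo b 0 = Ioi c) {p : M → Prop}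
    (hp : DefPred L fun v : Fin 1 → M => p (v 0)) :
    ∃ R, (∀ x, R < x → p x) ∨ ∀ x, R < x → ¬ p x := by
  obtain ⟨d, hd, h1⟩ := hO.germ_left (p := fun t => p (h t)) (hp.subst₁ (hh.subst₁ (.var 0))) 0
  obtain ⟨e, he, he0⟩ := exists_between (max_lt hb hd)
  rw [max_lt_iff] at he
  have key : ∀ x, h e < x → ∃ t, d < t ∧ t < 0 ∧ h t = x := fun x hx => by
    have hce : c < h e := by
      have := mem_image_of_mem h (show e ∈ Ioo b 0 from ⟨he.1, he0⟩)
      rwa [him] at this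
    obtain ⟨t, ht, rfl⟩ := him.ge (hce.trans hx)
    exact ⟨t, he.2.trans ((hmono.lt_iff_lt ⟨he.1, he0⟩ ht).1 hx), ht.2, rfl⟩
  refine ⟨h e, h1.imp (fun h1 x hx => ?_) fun h1 x hx => ?_⟩ <;>
  · obtain ⟨t, h2, h3, rfl⟩ := key x hx
    exact h1 t h2 h3

/-- Membership in `X` is eventually constant at `+∞`, and by reflection at `-∞`; the segment left
between is tame. -/
theorem LocallyOMinimal.oMinimal (hO : LocallyOMinimal L M) (hC : DefinablyComplete L M)
    (hE : IsExpansionOfOrderedGroup L M) (hA : Archimedean M) {h : M → M} {b c : M} (hb : b < 0)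
    (hh : DefTerm L fun v : Fin 1 → M => h (v 0)) (hmono : StrictMonoOn h (Ioo b 0))
    (him : h '' Ioo b 0 = Ioi c) : OMinimal L M := by
  intro X hX
  have hX' : DefPred L fun v : Fin 1 → M => v 0 ∈ X := hX
  obtain ⟨R, hR⟩ := hO.germ_atTop hb hh hmono him hX'
  obtain ⟨S, hS⟩ := hO.germ_atTop hb hh hmono him (p := fun x => -x ∈ X)
    (hX'.subst₁ (hE.neg (.var 0)))
  obtain ⟨e, he, hU⟩ := hO.exists_isFiniteUnion_inter_Icc hC hE hA hX' (-S) (max R (-S))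
  have hR' : Ioi e ⊆ X ∨ Ioi e ⊆ Xᶜ :=
    hR.imp (fun h x hx => h x (((le_max_left _ _).trans he).trans_lt hx))
      fun h x hx => h x (((le_max_left _ _).trans he).trans_lt hx)
  have hS' : Iio (-S) ⊆ X ∨ Iio (-S) ⊆ Xᶜ :=
    hS.imp (fun h x hx => by simpa using h (-x) (lt_neg.1 hx))
      fun h x hx => by simpa using h (-x) (lt_neg.1 hx)
  have huniv : X = X ∩ Iio (-S) ∪ X ∩ Icc (-S) e ∪ X ∩ Ioi e := by
    rw [← inter_union_distrib_left, ← inter_union_distrib_left, Iio_union_Icc_eq_Iic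
      ((le_max_right _ _).trans he), Iic_union_Ioi, inter_univ]
  rw [huniv]
  exact ((isFiniteUnion_inter_of_subset
    (IsOpenInterval.isFiniteUnion (.inr (.inr (.inl ⟨_, rfl⟩)))) hS').union hU).union
    (isFiniteUnion_inter_of_subset (IsOpenInterval.isFiniteUnion (.inr (.inl ⟨_, rfl⟩))) hR')

end OMinimality
-- Small oscillation forces boundedness.
section Oscillation

variable {L : FirstOrder.Language.{u, v}} {M : Type w} [L.Structure M]
  [LinearOrder M] [AddCommGroup M] [IsOrderedAddMonoid M] [DenselyOrdered M]

theorem exists_add_self_le {u : M} (hu : 0 < u) : ∃ e > 0, e + e ≤ u := by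
  obtain ⟨d, hd, hdu⟩ := exists_between hu
  refine ⟨min d (u - d), lt_min hd (sub_pos.2 hdu), ?_⟩
  calc _ ≤ d + (u - d) := add_le_add (min_le_left _ _) (min_le_right _ _)
    _ = u := add_sub_cancel _ _

/-- In an archimedean structure, if a definable function of two variables has locally small
oscillation in the second variable, uniformly in the first one, then it is bounded on any segment
uniformly in the first variable. -/
theorem DefinablyComplete.exists_bound (hC : DefinablyComplete L M)
    (hE : IsExpansionOfOrderedGroup L M) (hA : Archimedean M) {G : M → M → M}
    (hGd : DefTerm L fun v : Fin 2 → M => G (v 0) (v 1)) (hG0 : ∀ x, G x 0 = 0) {u c : M}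
    (hc : 0 ≤ c)
    (h : ∀ y₀, ∃ e > 0, ∀ x y, |y - y₀| ≤ e → |G x y - G x y₀| < u) :
    ∃ B, ∀ x, G x c ≤ B := by
  -- Compactness is used in `y` only: `x` ranges over all of `M` inside the predicate. The bound
  -- doubles to `u + u` because `y` and `y'` are both compared with the centre `y₀`.
  obtain ⟨e, he, hP⟩ := hC.exists_uniform hE (a := 0) (b := c)
    (P := fun y e => ∀ x y', y ≤ y' → y' ≤ y + e → G x y' - G x y ≤ u + u)
    (by
      apply_rules (maxDepth := 200) [DefPred.all, DefPred.imp, hE.le, hE.sub, hE.add,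
        hGd.subst₂, DefTerm.var, DefTerm.const])
    (fun x e e' hle h x' y' h1 h2 => h x' y' h1 (h2.trans (by gcongr)))
    (fun y₀ _ _ => by
      obtain ⟨e, he, h⟩ := h y₀
      obtain ⟨d, hd, hde⟩ := exists_add_self_le he
      refine ⟨d, hd, fun y hy x y' h1 h2 => ?_⟩
      rw [abs_lt] at hy
      have h3 := abs_lt.1 (h x y (abs_le.2 (by grind)))
      have h4 := abs_lt.1 (h x y' (abs_le.2 (by grind)))
      grind)
  -- Each step of length `e` costs at most `u + u`, starting from `G x 0 = 0`; the bound does not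
  -- involve `x`.
  have main : ∀ k : ℕ, ∀ y, 0 ≤ y → y ≤ c → y ≤ (k + 1) • e → ∀ x, G x y ≤ (k + 1) • (u + u) := by
    intro k
    induction k with
    | zero =>
      intro y hy hyc hye x
      have := hP 0 le_rfl hc x y hy (by simpa using hye)
      simpa [hG0] using this
    | succ k ih =>
      intro y hy hyc hye x
      have hu : 0 ≤ u := (abs_nonneg _).trans ((h 0).choose_spec.2 x 0 (by
        simpa using (h 0).choose_spec.1.le)).le
      rw [succ_nsmul] at hye ⊢
      rcases le_total y e with hle | hle
      · have h1 := ih 0 le_rfl hc (nsmul_nonneg he.le _) x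
        rw [hG0] at h1
        have h2 := hP 0 le_rfl hc x y hy (by simpa using hle)
        rw [hG0, sub_zero] at h2
        exact h2.trans (le_add_of_nonneg_left h1)
      · have h1 := ih (y - e) (sub_nonneg.2 hle) ((sub_le_self _ he.le).trans hyc)
          (sub_le_iff_le_add.2 hye) x
        have h2 := hP (y - e) (sub_nonneg.2 hle) ((sub_le_self _ he.le).trans hyc) x y
          (sub_le_self _ he.le) (by simp)
        exact (sub_le_iff_le_add'.1 h2).trans (by gcongr)
  obtain ⟨n, hn⟩ := hA.arch c he
  exact ⟨_, main n c hc le_rfl (hn.trans (nsmul_le_nsmul_left he.le n.le_succ))⟩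

end Oscillation

/-! ### The interpolating function and its singular height. -/

section Tietze

variable {L : FirstOrder.Language.{u, v}} {M : Type w} [L.Structure M]

/-- Here the value moves from the last coordinate of the graph to coordinate `0`. -/
theorem IsDefinableFun.defTerm {n : ℕ} {F : (Fin n → M) → M}
    (h : IsDefinableFun L fun x : (univ : Set (Fin n → M)) => F x) : DefTerm L F := by
  refine DefTerm.of_graph ?_
  have h' : DefPred L fun p : Fin (n + 1) → M =>
    ∃ a : (univ : Set (Fin n → M)), p = Fin.snoc (a : Fin n → M) (F a) := h
  refine (h'.subst (f := fun j v => v ((Fin.snoc Fin.succ 0 : Fin (n + 1) → Fin (n + 1)) j))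
    fun j => .var _).congr fun v => ?_
  constructor
  · rintro ⟨a, ha⟩
    have h0 := congrFun ha (Fin.last n)
    have h1 : (fun i => v (Fin.succ i)) = (a : Fin n → M) := by
      ext i
      simpa using congrFun ha i.castSucc
    simpa [h1] using h0
  · intro h0
    refine ⟨⟨fun i => v i.succ, mem_univ _⟩, ?_⟩
    ext j
    refine Fin.lastCases ?_ (fun i => ?_) j
    · simpa using h0
    · simp

variable [LinearOrder M] [AddCommGroup M] [TopologicalSpace M] [OrderTopology M]

/-- A definable continuous interpolation between the zero function at height `0` and the identity
function at height `c`. -/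
theorem DefinableTietze.exists_interpolation (hT : DefinableTietze L M) {c : M} (hc : c ≠ 0) :
    ∃ G : M → M → M, (DefTerm L fun v : Fin 2 → M => G (v 0) (v 1)) ∧
      Continuous (fun z : M × M => G z.1 z.2) ∧ (∀ x, G x 0 = 0) ∧ ∀ x, G x c = x := by
  classical
  let A : Set (Fin 2 → M) := {p | p 1 = 0 ∨ p 1 = c}
  have hA : DefPred L fun p : Fin 2 → M => p 1 = 0 ∨ p 1 = c :=
    (DefPred.eq (.var 1) (.const 0)).or (DefPred.eq (.var 1) (.const c))
  have hAc : IsClosed A := (isClosed_eq (continuous_apply 1) continuous_const).union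
    (isClosed_eq (continuous_apply 1) continuous_const)
  let f : A → M := fun a => if a.1 1 = 0 then 0 else a.1 0
  -- The two lines are disjoint closed sets covering `A`, so the piecewise definition of `f` is
  -- continuous.
  have hclopen : IsClopen {a : A | a.1 1 = 0} := by
    have h1 : Continuous fun a : A => a.1 1 := (continuous_apply 1).comp continuous_subtype_val
    refine ⟨isClosed_eq h1 continuous_const, ?_⟩
    have : {a : A | a.1 1 = 0}ᶜ = {a : A | a.1 1 = c} := by
      ext a
      simp only [mem_compl_iff, mem_ofPred_eq]
      exact ⟨fun h => a.2.resolve_left h, fun h h' => hc (h.symm.trans h')⟩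
    rw [← isClosed_compl_iff, this]
    exact isClosed_eq h1 continuous_const
  have hf : Continuous f := by
    refine Continuous.if (by simp [hclopen.frontier_eq]) continuous_const
      ((continuous_apply 0).comp continuous_subtype_val)
  have hfd : IsDefinableFun L f := by
    have : DefPred L fun p : Fin 3 → M => (p 1 = 0 ∧ p 2 = 0) ∨ (p 1 = c ∧ p 2 = p 0) := by
      apply_rules [DefPred.and, DefPred.or, DefPred.eq, DefTerm.var, DefTerm.const]
    refine this.congr fun p => ?_
    constructor
    · intro h
      have hpA : (![p 0, p 1] : Fin 2 → M) ∈ A := h.imp And.left And.left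
      refine ⟨⟨_, hpA⟩, funext fun j => ?_⟩
      have hp2 : p 2 = f ⟨_, hpA⟩ := by
        rcases h with h | h
        · simp [f, h.1, h.2]
        · simp [f, h.1, h.2, hc]
      refine Fin.lastCases ?_ (fun i => ?_) j
      · simpa using hp2
      · rw [Fin.snoc_castSucc]
        fin_cases i <;> rfl
    · rintro ⟨⟨a, ha⟩, rfl⟩
      have h0 : (Fin.snoc a (f ⟨a, ha⟩) : Fin 3 → M) 0 = a 0 :=
        Fin.snoc_castSucc (α := fun _ => M) _ _ 0
      have h1 : (Fin.snoc a (f ⟨a, ha⟩) : Fin 3 → M) 1 = a 1 :=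
        Fin.snoc_castSucc (α := fun _ => M) _ _ 1
      have h2 : (Fin.snoc a (f ⟨a, ha⟩) : Fin 3 → M) 2 = f ⟨a, ha⟩ :=
        Fin.snoc_last (α := fun _ => M) _ _
      rw [h0, h1, h2]
      rcases ha with ha | ha
      · exact .inl ⟨ha, by simp [f, ha]⟩
      · exact .inr ⟨ha, by simp [f, ha, hc]⟩
  obtain ⟨F, hF, hFd, hFf⟩ := hT 2 (by norm_num) A hA hAc f hf hfd
  refine ⟨fun x y => F ![x, y], ?_, ?_, fun x => ?_, fun x => ?_⟩
  · have heta : ∀ v : Fin 2 → M, ![v 0, v 1] = v := fun v => by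
      ext i
      fin_cases i <;> rfl
    simpa only [heta] using hFd.defTerm
  · refine hF.comp (continuous_pi fun i => ?_)
    fin_cases i
    · exact continuous_fst
    · exact continuous_snd
  · simpa [f] using hFf ⟨![x, 0], .inl rfl⟩
  · simpa [f, hc] using hFf ⟨![x, c], .inr rfl⟩

variable [IsOrderedAddMonoid M]

theorem exists_abs_sub_lt_of_continuous₂ [NoMaxOrder M] [NoMinOrder M] {G : M → M → M}
    (hG : Continuous (fun z : M × M => G z.1 z.2)) (x₀ y₀ : M) {u : M} (hu : 0 < u) :
    ∃ e > 0, ∀ x y, |x - x₀| < e → |y - y₀| < e → |G x y - G x₀ y₀| < u := by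
  have h : {z : M | |z - G x₀ y₀| < u} ∈ nhds (G x₀ y₀) :=
    (nhds_basis_abs_sub_lt _).mem_of_mem hu
  have h' := hG.tendsto (x₀, y₀) h
  obtain ⟨⟨e₁, e₂⟩, ⟨he₁, he₂⟩, h'⟩ :=
    ((nhds_basis_abs_sub_lt x₀).prod_nhds (nhds_basis_abs_sub_lt y₀)).mem_iff.1 h'
  exact ⟨min e₁ e₂, lt_min he₁ he₂, fun x y hx hy =>
    h' (a := (x, y)) ⟨hx.trans_le (min_le_left _ _), hy.trans_le (min_le_right _ _)⟩⟩

variable [DenselyOrdered M]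

/-- Around any height, a definable continuous function oscillates little over bounded sets. -/
theorem DefinablyComplete.exists_uniform_oscillation [Nontrivial M] (hC : DefinablyComplete L M)
    (hE : IsExpansionOfOrderedGroup L M) {G : M → M → M}
    (hGd : DefTerm L fun v : Fin 2 → M => G (v 0) (v 1))
    (hG : Continuous (fun z : M × M => G z.1 z.2)) (y₀ : M) {u : M} (hu : 0 < u) (a b : M) :
    ∃ e > 0, ∀ x, a ≤ x → x ≤ b → ∀ y, |y - y₀| < e → |G x y - G x y₀| < u := by
  refine hC.exists_uniform hE (P := fun x e => ∀ y, |y - y₀| < e → |G x y - G x y₀| < u) ?_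
    (fun x e e' he h y hy => h y (hy.trans_le he)) fun x _ _ => ?_
  · apply_rules (maxDepth := 200) [DefPred.all, DefPred.imp, hE.abs_lt, hE.sub, hGd.subst₂,
      DefTerm.var, DefTerm.const]
  · obtain ⟨u', hu', hle⟩ := exists_add_self_le hu
    obtain ⟨e, he, h⟩ := exists_abs_sub_lt_of_continuous₂ hG x y₀ hu'
    refine ⟨e, he, fun x' hx' y hy => ?_⟩
    have h1 := abs_lt.1 (h x' y hx' hy)
    have h2 := abs_lt.1 (h x' y₀ hx' (by simpa using he))
    rw [abs_lt]
    grind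

variable [Nontrivial M]

theorem DefinableTietze.exists_unbounded_strictMonoOn (hT : DefinableTietze L M)
    (hO : LocallyOMinimal L M) (hC : DefinablyComplete L M)
    (hE : IsExpansionOfOrderedGroup L M) (hA : Archimedean M) :
    ∃ (h : M → M) (b c : M), b < 0 ∧ (DefTerm L fun v : Fin 1 → M => h (v 0)) ∧
      StrictMonoOn h (Ioo b 0) ∧ h '' Ioo b 0 = Ioi c := by
  obtain ⟨u, hu⟩ := exists_gt (0 : M)
  obtain ⟨G, hGd, hG, hG0, hGu⟩ := hT.exists_interpolation hu.ne'
  -- Without such a height, `G x u = x` would be bounded above.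
  obtain ⟨y₀, hy₀⟩ : ∃ y₀, ∀ e > 0, ∃ x y, |y - y₀| ≤ e ∧ u ≤ |G x y - G x y₀| := by
    by_contra! hcon
    obtain ⟨B, hB⟩ := hC.exists_bound hE hA hGd hG0 hu.le hcon
    obtain ⟨x, hx⟩ := exists_gt B
    exact (hGu x ▸ hB x).not_gt hx
  refine hO.exists_unbounded_strictMonoOn hC hE hA
    (Q := fun t r => ∃ x y, |x| ≤ r ∧ |y - y₀| ≤ -t ∧ u ≤ |G x y - G x y₀|)
    ?_ (fun t ht => ?_) ?_ ?_ fun R => ?_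
  · have : DefPred L fun v : Fin 2 → M => ∃ x y, |x| ≤ v 1 ∧ |y - y₀| ≤ - v 0 ∧
        ¬ |G x y - G x y₀| < u := by
      apply_rules (maxDepth := 200) [DefPred.ex, DefPred.and, hE.abs_le, DefPred.not, hE.abs_lt,
        hE.sub, hE.neg, hGd.subst₂, DefTerm.var, DefTerm.const]
    simpa only [not_lt] using this
  · obtain ⟨x, y, h1, h2⟩ := hy₀ (-t) (neg_pos.2 ht)
    exact ⟨|x|, x, y, le_rfl, h1, h2⟩
  · rintro t - r ⟨x, y, h1, -⟩
    exact (abs_nonneg x).trans h1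
  · rintro s t r hst ⟨x, y, h1, h2, h3⟩
    exact ⟨x, y, h1, h2.trans (neg_le_neg hst), h3⟩
  -- For `|x| ≤ R` the oscillation stays below `u` at scales under `e`, so large oscillation forces
  -- `|x| > R`.
  · obtain ⟨e, he, h⟩ := hC.exists_uniform_oscillation hE hGd hG y₀ hu (-R) R
    refine ⟨-e, neg_neg_of_pos he, ?_⟩
    rintro t ht - r ⟨x, y, h1, h2, h3⟩
    by_contra! hle
    obtain ⟨h4, h5⟩ := abs_le.1 (h1.trans hle)
    exact (h x h4 h5 y (h2.trans_lt (neg_lt.1 ht))).not_ge h3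

end Tietze

end LocOMin

theorem theorem5p5 (L : FirstOrder.Language.{u, v}) (M : Type w) [L.Structure M]
    [AddCommGroup M] [LinearOrder M] [IsOrderedAddMonoid M] [DenselyOrdered M] [Nontrivial M]
    [TopologicalSpace M] [OrderTopology M]
    (hM : LocOMin.IsDCULOAS L M) (hArch : Archimedean M) (hTietze : LocOMin.DefinableTietze L M) :
    LocOMin.HasBoundedUnboundedHomeo L M ∧ LocOMin.OMinimal L M := by
  obtain ⟨hE, hC, hO, -⟩ := hM
  obtain ⟨h, b, c, hb, hh, hmono, him⟩ := hTietze.exists_unbounded_strictMonoOn hO hC hE hArch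
  exact ⟨LocOMin.hasBoundedUnboundedHomeo_of_image_eq_Ioi hb hE hh hmono him,
    hO.oMinimal hC hE hArch hb hh hmono him⟩
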